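/- **Setting.** Let $d$ be a natural number, $n=(n_1,\dots,n_d)$ and $r=(r_1,\dots,r_d)$. Tensors in $\mathbb R^{n_1\times\dots\times n_d}$ carry the Euclidean norm $\|\cdot\|$ of the vector of entries. $\mathbf{Mat}_i(Y)\in\mathbb R^{n_i\times\prod_{j\ne i}n_j}$ denotes the $i$-mode matricization and $\mathit{Ten}_i$ its inverse; $C\times_{i=1}^d\mathbf U_i$ denotes the tensor with entries $\sum_{j_1,\dots,j_d}c_{j_1\dots j_d}(\mathbf U_1)_{k_1j_1}\cdots(\mathbf U_d)_{k_dj_d}$. Let $\mathcal M$ be the manifold of tensors of multilinear rank $r$, i.e. with $\operatorname{rank}\mathbf{Mat}_i(Y)=r_i$ for all $i$, and let $\mathrm P(Y)$ be the orthogonal projection onto the tangent space of $\mathcal M$ at $Y\in\mathcal M$. **The integrator.** One step of the rank-$r$ Tucker integrator for $\dot Y=F(t,Y)$ from $t_0$ to $t_1=t_0+h$ starts from $Y_0=C_0\times_{i=1}^d\mathbf U_i^0$, where $C_0\in\mathbb R^{r_1\times\dots\times r_d}$ and the $\mathbf U_i^0\in\mathbb R^{n_i\times r_i}$ have orthonormal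 columns. (1) For each $i$: take a QR factorization $\mathbf{Mat}_i(C_0)^\top=\mathbf Q_i\mathbf S_i^{0,\top}$, put $\mathbf V_i^{0,\top}=\mathbf Q_i^\top\bigotimes_{j\ne i}\mathbf U_j^{0,\top}$, solve $\dot{\mathbf K}_i(t)=\mathbf{Mat}_i\big(F(t,\mathit{Ten}_i(\mathbf K_i(t)\mathbf V_i^{0,\top}))\big)\mathbf V_i^0$, $\mathbf K_i(t_0)=\mathbf U_i^0\mathbf S_i^0$, on $[t_0,t_1]$, take a QR factorization $\mathbf K_i(t_1)=\mathbf U_i^1\mathbf R_i^1$ and put $\mathbf M_i=\mathbf U_i^{1,\top}\mathbf U_i^0$. (2) Solve $\dot C(t)=F\big(t,C(t)\times_{i=1}^d\mathbf U_i^1\big)\times_{i=1}^d\mathbf U_i^{1,\top}$, $C(t_0)=C_0\times_{i=1}^d\mathbf M_i$, on $[t_0,t_1]$, and set $C_1=C(t_1)$, $Y_1=C_1\times_{i=1}^d\mathbf U_i^1$. The result $Y_1$ is the starting value of the next step. **Theorem (robust error bound).** For all $d$, $L$, $B$, $T$ there are constants $c_0,c_1,c_2\ge0$, depending only on $L,B,T,d$,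 such that the following holds for all $n$, $r$, $F$, $A$, all $\varepsilon,\delta\ge0$, and $h,\rho>0$. Let $A:[0,T]\to\mathbb R^{n_1\times\dots\times n_d}$ solve $\dot A(t)=F(t,A(t))$, $A(0)=A_0$, and assume: 1. $\|F(t,X)-F(t,X')\|\le L\|X-X'\|$ and $\|F(t,X)\|\le B$ for all tensors $X,X'$ and $0\le t\le T$; 2. $\|(I-\mathrm P(X))F(t,X)\|\le\varepsilon$ for all $0\le t\le T$ and all $X\in\mathcal M$ with $\|X-A(t)\|<\rho$; 3. $Y_0\in\mathcal M$ and $\|Y_0-A_0\|\le\delta$. Let $Y_k$ be obtained after $k$ steps of the integrator with step size $h$ from $Y_0$, and let $t_k=kh$. If $c_0\delta+c_1\varepsilon+c_2h\le\rho$, then for all $k$ with $t_k\le T$ $$\|Y_k-A(t_k)\|\le c_0\delta+c_1\varepsilon+c_2h .$$ In particular the constants are independent of $n$, $r$, $\rho$ and of the singular values of matricizations of the exact or approximate solution. (If condition 2 holds for all $X\in\mathcal M$, the condition on $\rho$ can be dropped.) -/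

import Mathlib

open scoped Matrix Topology

noncomputable section

namespace TuckerIntegrator

/-- Real tensors of size `n 0 × ⋯ × n (d-1)`, with the Euclidean norm of the vector of entries. -/
abbrev Tensor {d : ℕ} (n : Fin d → ℕ) : Type :=
  EuclideanSpace ℝ ((i : Fin d) → Fin (n i))

/-- Multi-indices in all modes except the `i`-th one. -/
abbrev CoIndex {d : ℕ} (n : Fin d → ℕ) (i : Fin d) : Type :=
  (j : {j : Fin d // j ≠ i}) → Fin (n j)

/-- The `i`-mode matricization: rows are indexed by the `i`-th index of the tensor, columns by
all the other indices. -/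
def mat {d : ℕ} {n : Fin d → ℕ} (i : Fin d) (Y : Tensor n) :
    Matrix (Fin (n i)) (CoIndex n i) ℝ :=
  Matrix.of fun a b => Y ((Equiv.piSplitAt i fun j => Fin (n j)).symm (a, b))

/-- The `i`-mode tensorization, the inverse of `mat i`. -/
def ten {d : ℕ} {n : Fin d → ℕ} (i : Fin d) (M : Matrix (Fin (n i)) (CoIndex n i) ℝ) :
    Tensor n :=
  WithLp.toLp 2 fun k =>
    M (Equiv.piSplitAt i (fun j => Fin (n j)) k).1 (Equiv.piSplitAt i (fun j => Fin (n j)) k).2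

theorem ten_mat {d : ℕ} {n : Fin d → ℕ} (i : Fin d) (Y : Tensor n) : ten i (mat i Y) = Y := by
  ext k
  simp only [ten, mat, Matrix.of_apply, Prod.mk.eta, Equiv.symm_apply_apply]

theorem mat_ten {d : ℕ} {n : Fin d → ℕ} (i : Fin d) (M : Matrix (Fin (n i)) (CoIndex n i) ℝ) :
    mat i (ten i M) = M := by
  ext a b
  simp only [ten, mat, Matrix.of_apply, Equiv.apply_symm_apply]

/-- The multilinear (Tucker) product `C ×₁ U₁ ×₂ ⋯ ×_d U_d`. -/
def tucker {d : ℕ} {r n : Fin d → ℕ} (C : Tensor r)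
    (U : (i : Fin d) → Matrix (Fin (n i)) (Fin (r i)) ℝ) : Tensor n :=
  WithLp.toLp 2 fun k => ∑ l : ((i : Fin d) → Fin (r i)), C l * ∏ i, U i (k i) (l i)

/-- The Kronecker product of the matrices `U j`, `j ≠ i`. -/
def kronExcept {d : ℕ} {r n : Fin d → ℕ} (i : Fin d)
    (U : (i : Fin d) → Matrix (Fin (n i)) (Fin (r i)) ℝ) :
    Matrix (CoIndex n i) (CoIndex r i) ℝ :=
  Matrix.of fun b c => ∏ j : {j : Fin d // j ≠ i}, U j (b j) (c j)

/-- The set of tensors of multilinear rank `(r 0, …, r (d-1))`. -/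
def rankManifold {d : ℕ} (n r : Fin d → ℕ) : Set (Tensor n) :=
  {Y | ∀ i, (mat i Y).rank = r i}

/-- The tangent space at `Y` of the manifold of tensors of multilinear rank `r`, consisting of
the velocities at `Y` of `C¹` curves in the manifold. (At points of the manifold these velocities
form a linear subspace, so that taking the span adds nothing.) -/
def tangentSpace {d : ℕ} {n : Fin d → ℕ} (r : Fin d → ℕ) (Y : Tensor n) :
    Submodule ℝ (Tensor n) :=
  Submodule.span ℝ {Z | ∃ γ : ℝ → Tensor n, γ 0 = Y ∧ ContDiffAt ℝ 1 γ 0 ∧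
    (∀ᶠ s in 𝓝 (0 : ℝ), γ s ∈ rankManifold n r) ∧ HasDerivAt γ Z 0}

/-- The orthogonal projection `P(Y)` onto the tangent space at `Y`. -/
def tangentProj {d : ℕ} {n : Fin d → ℕ} (r : Fin d → ℕ) (Y : Tensor n) :
    Tensor n →L[ℝ] Tensor n :=
  (tangentSpace r Y).starProjection

/-- `M = Q R` is a (slim) QR factorization: `Q` has orthonormal columns, and `R` is square and
upper triangular. -/
def IsQR {ι : Type*} [Fintype ι] {r : ℕ} (M Q : Matrix ι (Fin r) ℝ)
    (R : Matrix (Fin r) (Fin r) ℝ) : Prop :=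
  Qᵀ * Q = 1 ∧ R.BlockTriangular id ∧ M = Q * R

/-- The basis update in mode `i`, from `U0 i` to `U1`, over the time interval `[t0, t1]`,
starting from the Tucker tensor with core `C0` and basis matrices `U0`. The QR factorization of
the transposed matricization of the core is `Q * S0ᵀ`, and `V0` has the transpose
`Qᵀ * ⨂_{j ≠ i} (U0 j)ᵀ`. -/
def IsBasisUpdate {d : ℕ} {n r : Fin d → ℕ} (F : ℝ → Tensor n → Tensor n) (t0 t1 : ℝ)
    (C0 : Tensor r) (U0 : (i : Fin d) → Matrix (Fin (n i)) (Fin (r i)) ℝ) (i : Fin d)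
    (U1 : Matrix (Fin (n i)) (Fin (r i)) ℝ) : Prop :=
  ∃ (Q : Matrix (CoIndex r i) (Fin (r i)) ℝ) (S0 R1 : Matrix (Fin (r i)) (Fin (r i)) ℝ)
    (V0 : Matrix (CoIndex n i) (Fin (r i)) ℝ) (K : ℝ → Matrix (Fin (n i)) (Fin (r i)) ℝ),
    IsQR (mat i C0)ᵀ Q S0ᵀ ∧
    V0 = kronExcept i U0 * Q ∧
    K t0 = U0 i * S0 ∧
    (∀ t ∈ Set.Icc t0 t1, ∀ a b, HasDerivWithinAt (fun s => K s a b)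
      ((mat i (F t (ten i (K t * V0ᵀ))) * V0) a b) (Set.Icc t0 t1) t) ∧
    IsQR (K t1) U1 R1

/-- The core update from `C0` to `C1` over the time interval `[t0, t1]`, with the old basis
matrices `U0` and the updated ones `U1`. -/
def IsCoreUpdate {d : ℕ} {n r : Fin d → ℕ} (F : ℝ → Tensor n → Tensor n) (t0 t1 : ℝ)
    (C0 : Tensor r) (U0 U1 : (i : Fin d) → Matrix (Fin (n i)) (Fin (r i)) ℝ)
    (C1 : Tensor r) : Prop :=
  ∃ C : ℝ → Tensor r,
    C t0 = tucker C0 (fun i => (U1 i)ᵀ * U0 i) ∧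
    (∀ t ∈ Set.Icc t0 t1, HasDerivWithinAt C
      (tucker (F t (tucker (C t) U1)) (fun i => (U1 i)ᵀ)) (Set.Icc t0 t1) t) ∧
    C1 = C t1

/-- One step of the Tucker integrator with rank `r` for `Y' = F(t, Y)`, from `Y0` at `t0` to
`Y1` at `t1`. The starting tensor is given in a factorized form with orthonormal bases; the
differential equations of the substeps are solved exactly. -/
def IsStep {d : ℕ} {n : Fin d → ℕ} (r : Fin d → ℕ) (F : ℝ → Tensor n → Tensor n) (t0 t1 : ℝ)
    (Y0 Y1 : Tensor n) : Prop :=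
  ∃ (C0 C1 : Tensor r) (U0 U1 : (i : Fin d) → Matrix (Fin (n i)) (Fin (r i)) ℝ),
    (∀ i, (U0 i)ᵀ * U0 i = 1) ∧
    Y0 = tucker C0 U0 ∧
    (∀ i, IsBasisUpdate F t0 t1 C0 U0 i (U1 i)) ∧
    IsCoreUpdate F t0 t1 C0 U0 U1 C1 ∧
    Y1 = tucker C1 U1

end TuckerIntegrator

end

/-! One step is compared with `E = Y0 + (A t1 - A t0)`, the starting value plus the exact increment.
Its error against `E` is of order `h * (e + h + ε)`, where `e` is the current error; adding `e` and
summing with a discrete Gronwall argument gives the bound.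

Basis updates (`IsBasisUpdate.mode_defect_le`): the tensor `W` with matricization `K * V0ᵀ` solves
the equation with its right-hand side projected by `V0 * V0ᵀ`, starts at `Y0`, and ends with range
in the span of `U1`. Put `P = 1 - U1 * U1ᵀ`. Then `P` kills `W t1`, so the part of `E` missed by
`U1` is `P` applied to the increment of `A - W`. Up to Lipschitz differences, its derivative is `F t
(W t1)` multiplied by `P` on the left and `1 - V0 * V0ᵀ` on the right. Tangent vectors have no such
component, since to first order a curve of constant rank maps the kernel into the range; so this
term is at most `ε`. As `W t1` may be rank-deficient, that bound is obtained as a limit from nearby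
points of the manifold (`norm_sandwich_le_of_normal_part_le`).

Core update (`IsStep.local_error_le`): it is the flow projected to the new bases, started at the
projection of `Y0`. Projecting `E` costs at most the sum of the mode defects, and the rest is a
Lipschitz estimate.

Only orthogonal projections act on errors and no core matrix is inverted in these estimates, so
singular values never enter the constants. -/

noncomputable section

namespace TuckerIntegrator

/-! ### Multilinear algebra: Tucker products, matricizations, mode projections. -/

section Algebra

variable {d : ℕ} {q r n : Fin d → ℕ}

theorem tucker_tucker (C : Tensor q) (U : (i : Fin d) → Matrix (Fin (r i)) (Fin (q i)) ℝ)
    (W : (i : Fin d) → Matrix (Fin (n i)) (Fin (r i)) ℝ) :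
    tucker (tucker C U) W = tucker C (fun i => W i * U i) := by
  ext k
  simp only [tucker, Matrix.mul_apply, Finset.prod_univ_sum, Fintype.piFinset_univ,
    Finset.sum_mul, Finset.mul_sum]
  rw [Finset.sum_comm]
  refine Finset.sum_congr rfl fun l _ => Finset.sum_congr rfl fun m _ => ?_
  rw [Finset.prod_mul_distrib]
  ring

theorem tucker_one (C : Tensor n) : tucker C (fun _ => 1) = C := by
  ext k
  simp only [tucker, Matrix.one_apply, Finset.prod_ite_zero, Finset.prod_const_one]
  rw [Finset.sum_eq_single k]
  · simp
  · intro l _ hl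
    rw [if_neg, mul_zero]
    intro h
    exact hl (funext fun i => (h i (Finset.mem_univ i)).symm)
  · simp

theorem mat_tucker (i : Fin d) (C : Tensor r)
    (U : (i : Fin d) → Matrix (Fin (n i)) (Fin (r i)) ℝ) :
    mat i (tucker C U) = U i * mat i C * (kronExcept i U)ᵀ := by
  ext a b
  simp only [mat, tucker, kronExcept, Matrix.mul_apply, Matrix.of_apply, Matrix.transpose_apply,
    Finset.sum_mul]
  rw [← (Equiv.piSplitAt i fun j => Fin (r j)).symm.sum_comp, Fintype.sum_prod_type,
    Finset.sum_comm]
  refine Finset.sum_congr rfl fun y _ => Finset.sum_congr rfl fun x _ => ?_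
  rw [Fintype.prod_eq_mul_prod_subtype_ne _ i]
  have h1 : ∀ (m : Fin d → ℕ) (u : Fin (m i)) (v : CoIndex m i),
      (Equiv.piSplitAt i fun j => Fin (m j)).symm (u, v) i = u := by
    intro m u v; simp
  have h2 : ∀ (m : Fin d → ℕ) (u : Fin (m i)) (v : CoIndex m i) (j : {j // j ≠ i}),
      (Equiv.piSplitAt i fun j => Fin (m j)).symm (u, v) j = v j := by
    intro m u v j; simp [j.2]
  simp only [h1, h2]
  ring

theorem kronExcept_mul (i : Fin d) (W : (i : Fin d) → Matrix (Fin (n i)) (Fin (r i)) ℝ)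
    (U : (i : Fin d) → Matrix (Fin (r i)) (Fin (q i)) ℝ) :
    kronExcept i W * kronExcept i U = kronExcept i (fun i => W i * U i) := by
  ext b c
  simp only [kronExcept, Matrix.mul_apply, Matrix.of_apply, Finset.prod_univ_sum,
    Fintype.piFinset_univ, Finset.prod_mul_distrib]

theorem kronExcept_transpose (i : Fin d) (U : (i : Fin d) → Matrix (Fin (n i)) (Fin (r i)) ℝ) :
    (kronExcept i U)ᵀ = kronExcept i (fun i => (U i)ᵀ) := by
  ext b c
  simp [kronExcept]

theorem kronExcept_congr (i : Fin d) {U W : (i : Fin d) → Matrix (Fin (n i)) (Fin (r i)) ℝ}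
    (h : ∀ j, j ≠ i → U j = W j) : kronExcept i U = kronExcept i W := by
  ext b c
  simp only [kronExcept, Matrix.of_apply]
  exact Finset.prod_congr rfl fun j _ => by rw [h j j.2]

theorem kronExcept_one (i : Fin d) :
    kronExcept i (fun j => (1 : Matrix (Fin (n j)) (Fin (n j)) ℝ)) = 1 := by
  ext b c
  simp only [kronExcept, Matrix.of_apply, Matrix.one_apply, Finset.prod_ite_zero,
    Finset.prod_const_one, Finset.mem_univ, true_implies, funext_iff]

theorem mat_injective (i : Fin d) : Function.Injective (mat (n := n) i) :=
  Function.LeftInverse.injective (ten_mat i)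

theorem mat_add (i : Fin d) (X Y : Tensor n) : mat i (X + Y) = mat i X + mat i Y := rfl

theorem mat_sub (i : Fin d) (X Y : Tensor n) : mat i (X - Y) = mat i X - mat i Y := rfl

theorem mat_smul (i : Fin d) (c : ℝ) (X : Tensor n) : mat i (c • X) = c • mat i X := rfl

theorem tucker_add (X Y : Tensor r) (U : (i : Fin d) → Matrix (Fin (n i)) (Fin (r i)) ℝ) :
    tucker (X + Y) U = tucker X U + tucker Y U := by
  ext k
  simp [tucker, add_mul, Finset.sum_add_distrib]

theorem tucker_smul (c : ℝ) (X : Tensor r)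
    (U : (i : Fin d) → Matrix (Fin (n i)) (Fin (r i)) ℝ) :
    tucker (c • X) U = c • tucker X U := by
  ext k
  simp [tucker, Finset.mul_sum, mul_assoc]

/-- The Tucker product with fixed matrices, as a continuous linear map of the core. -/
def tuckerCLM (U : (i : Fin d) → Matrix (Fin (n i)) (Fin (r i)) ℝ) : Tensor r →L[ℝ] Tensor n :=
  LinearMap.toContinuousLinearMap
    { toFun := fun C => tucker C U
      map_add' := fun X Y => tucker_add X Y U
      map_smul' := fun c X => tucker_smul c X U }

@[simp] theorem tuckerCLM_apply (U : (i : Fin d) → Matrix (Fin (n i)) (Fin (r i)) ℝ)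
    (C : Tensor r) : tuckerCLM U C = tucker C U := rfl

/-- The linear map that multiplies the `i`-mode matricization by `P` from the left and by `N` from
the right. -/
def sandwich (i : Fin d) (P : Matrix (Fin (n i)) (Fin (n i)) ℝ)
    (N : Matrix (CoIndex n i) (CoIndex n i) ℝ) : Tensor n →L[ℝ] Tensor n :=
  LinearMap.toContinuousLinearMap
    { toFun := fun X => ten i (P * mat i X * N)
      map_add' := fun X Y => mat_injective i <| by
        simp only [mat_add, mat_ten, Matrix.mul_add, Matrix.add_mul]
      map_smul' := fun c X => mat_injective i <| by
        simp only [mat_smul, mat_ten, Matrix.mul_smul, Matrix.smul_mul, RingHom.id_apply] }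

theorem sandwich_apply (i : Fin d) (P : Matrix (Fin (n i)) (Fin (n i)) ℝ)
    (N : Matrix (CoIndex n i) (CoIndex n i) ℝ) (X : Tensor n) :
    sandwich i P N X = ten i (P * mat i X * N) := rfl

theorem mat_sandwich (i : Fin d) (P : Matrix (Fin (n i)) (Fin (n i)) ℝ)
    (N : Matrix (CoIndex n i) (CoIndex n i) ℝ) (X : Tensor n) :
    mat i (sandwich i P N X) = P * mat i X * N := mat_ten _ _

theorem sandwich_sandwich (i : Fin d) (P P' : Matrix (Fin (n i)) (Fin (n i)) ℝ)
    (N N' : Matrix (CoIndex n i) (CoIndex n i) ℝ) (X : Tensor n) :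
    sandwich i P N (sandwich i P' N' X) = sandwich i (P * P') (N' * N) X :=
  mat_injective i <| by simp only [mat_sandwich, Matrix.mul_assoc]

theorem inner_ten_left (i : Fin d) (M : Matrix (Fin (n i)) (CoIndex n i) ℝ) (X : Tensor n) :
    inner ℝ (ten i M) X = Matrix.trace (Mᵀ * mat i X) := by
  have h : inner ℝ (ten i M) X = ∑ k, ten i M k * X k := by
    simp [PiLp.inner_apply, mul_comm]
  rw [h, ← (Equiv.piSplitAt i fun j => Fin (n j)).symm.sum_comp, Fintype.sum_prod_type,
    Finset.sum_comm]
  simp only [Matrix.trace, Matrix.diag, Matrix.mul_apply, Matrix.transpose_apply, ten, mat,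
    Matrix.of_apply, Equiv.apply_symm_apply]

theorem inner_sandwich_left (i : Fin d) (P : Matrix (Fin (n i)) (Fin (n i)) ℝ)
    (N : Matrix (CoIndex n i) (CoIndex n i) ℝ) (X Y : Tensor n) :
    inner ℝ (sandwich i P N X) Y = inner ℝ X (sandwich i Pᵀ Nᵀ Y) := by
  conv_rhs => rw [← ten_mat i X]
  rw [sandwich_apply, inner_ten_left, inner_ten_left, mat_sandwich]
  simp only [Matrix.transpose_mul, Matrix.mul_assoc]
  rw [Matrix.trace_mul_comm]
  simp only [Matrix.mul_assoc]

theorem inner_tucker_left (C : Tensor r) (U : (i : Fin d) → Matrix (Fin (n i)) (Fin (r i)) ℝ)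
    (Y : Tensor n) : inner ℝ (tucker C U) Y = inner ℝ C (tucker Y fun i => (U i)ᵀ) := by
  simp only [PiLp.inner_apply, tucker, RCLike.inner_apply, conj_trivial, Finset.mul_sum,
    Finset.sum_mul, Matrix.transpose_apply]
  rw [Finset.sum_comm]
  exact Finset.sum_congr rfl fun l _ => Finset.sum_congr rfl fun m _ => by ring

/-- Symmetric idempotent linear maps are contractions. -/
theorem norm_le_of_symmetric_of_idempotent {E : Type*} [NormedAddCommGroup E]
    [InnerProductSpace ℝ E] {f : E → E} (hs : ∀ x y, inner ℝ (f x) y = inner ℝ x (f y))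
    (hi : ∀ x, f (f x) = f x) (x : E) : ‖f x‖ ≤ ‖x‖ := by
  have h : ‖f x‖ * ‖f x‖ ≤ ‖x‖ * ‖f x‖ := by
    rw [← real_inner_self_eq_norm_mul_norm, hs, hi]
    exact real_inner_le_norm _ _
  rcases (norm_nonneg (f x)).eq_or_lt with h0 | h0
  · rw [← h0]; exact norm_nonneg x
  · exact le_of_mul_le_mul_right h h0

theorem norm_sandwich_le (i : Fin d) {P : Matrix (Fin (n i)) (Fin (n i)) ℝ}
    {N : Matrix (CoIndex n i) (CoIndex n i) ℝ} (hP : Pᵀ = P) (hP2 : P * P = P) (hN : Nᵀ = N)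
    (hN2 : N * N = N) (X : Tensor n) : ‖sandwich i P N X‖ ≤ ‖X‖ :=
  norm_le_of_symmetric_of_idempotent (f := sandwich i P N)
    (fun x y => by rw [inner_sandwich_left, hP, hN])
    (fun x => by rw [sandwich_sandwich, hP2, hN2]) X

theorem norm_tucker_le {P : (i : Fin d) → Matrix (Fin (n i)) (Fin (n i)) ℝ}
    (hP : ∀ i, (P i)ᵀ = P i) (hP2 : ∀ i, P i * P i = P i) (X : Tensor n) :
    ‖tucker X P‖ ≤ ‖X‖ :=
  norm_le_of_symmetric_of_idempotent (f := fun X => tucker X P)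
    (fun x y => by simp only [inner_tucker_left, hP])
    (fun x => by simp only [tucker_tucker, hP2]) X

theorem sandwich_one_right (i : Fin d) (P : Matrix (Fin (n i)) (Fin (n i)) ℝ) (X : Tensor n) :
    sandwich i P 1 X = tucker X (Function.update (fun _ => 1) i P) := by
  apply mat_injective i
  rw [mat_sandwich, mat_tucker, Function.update_self, kronExcept_congr i (W := fun _ => 1),
    kronExcept_one, Matrix.transpose_one]
  intro j hj
  rw [Function.update_of_ne hj]

/-- A product of orthogonal projections in the single modes differs from the identity by at most
the sum of the differences in the single modes. -/
theorem norm_sub_tucker_le {P : (i : Fin d) → Matrix (Fin (n i)) (Fin (n i)) ℝ}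
    (hP : ∀ i, (P i)ᵀ = P i) (hP2 : ∀ i, P i * P i = P i) (X : Tensor n) :
    ‖X - tucker X P‖ ≤ ∑ i, ‖sandwich i (1 - P i) 1 X‖ := by
  classical
  -- The projections are switched on one mode at a time: `1 - P_S P_i = (1 - P_S) + P_S (1 - P_i)`,
  -- and the factor `P_S` is a contraction.
  have key : ∀ S : Finset (Fin d),
      ‖X - tucker X (fun i => if i ∈ S then P i else 1)‖ ≤
        ∑ i ∈ S, ‖sandwich i (1 - P i) 1 X‖ := by
    intro S
    induction S using Finset.induction_on with
    | empty => simp [tucker_one]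
    | insert i S hi ih =>
      set PS : (i : Fin d) → Matrix (Fin (n i)) (Fin (n i)) ℝ :=
        fun i => if i ∈ S then P i else 1 with hPS
      have h1 : tucker X (fun j => if j ∈ insert i S then P j else 1) =
          tucker (sandwich i (P i) 1 X) PS := by
        rw [sandwich_one_right, tucker_tucker]
        congr 1
        funext j
        by_cases hj : j = i
        · subst hj; simp [hPS, hi]
        · simp [hPS, hj]
      have h2 : X - tucker X (fun j => if j ∈ insert i S then P j else 1) =
          (X - tucker X PS) + tucker (sandwich i (1 - P i) 1 X) PS := by
        have h3 : sandwich i (1 - P i) 1 X = X - sandwich i (P i) 1 X :=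
          mat_injective i <| by
            simp only [mat_sandwich, mat_sub, Matrix.mul_one, Matrix.sub_mul, Matrix.one_mul]
        have h4 := map_sub (tuckerCLM PS) X (sandwich i (P i) 1 X)
        simp only [tuckerCLM_apply] at h4
        rw [h1, h3, h4]
        abel
      rw [h2, Finset.sum_insert hi, add_comm]
      refine (norm_add_le _ _).trans (add_le_add ?_ ih)
      refine norm_tucker_le (fun j => ?_) (fun j => ?_) _
      · simp only [hPS]; split_ifs <;> simp [hP]
      · simp only [hPS]; split_ifs <;> simp [hP2]
  simpa using key Finset.univ

theorem rank_mat_tucker_le (i : Fin d) (C : Tensor r)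
    (U : (i : Fin d) → Matrix (Fin (n i)) (Fin (r i)) ℝ) :
    (mat i (tucker C U)).rank ≤ (mat i C).rank := by
  rw [mat_tucker]
  exact (Matrix.rank_mul_le_left _ _).trans (Matrix.rank_mul_le_right _ _)

theorem rank_mat_tucker_eq (i : Fin d) (C : Tensor r)
    {U : (i : Fin d) → Matrix (Fin (n i)) (Fin (r i)) ℝ}
    {W : (i : Fin d) → Matrix (Fin (r i)) (Fin (n i)) ℝ} (h : ∀ i, W i * U i = 1) :
    (mat i (tucker C U)).rank = (mat i C).rank := by
  refine (rank_mat_tucker_le i C U).antisymm ?_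
  have h1 := rank_mat_tucker_le i (tucker C U) W
  simpa only [tucker_tucker, h, tucker_one] using h1

end Algebra

/-! ### Normal directions of the rank manifold and limits at points of lower rank. -/

section Normal

variable {d : ℕ} {r n : Fin d → ℕ}

/-- The product of the `i`-mode matricization with a fixed vector. -/
def matMulVec (i : Fin d) (v : CoIndex n i → ℝ) : Tensor n →L[ℝ] (Fin (n i) → ℝ) :=
  LinearMap.toContinuousLinearMap
    { toFun := fun X => mat i X *ᵥ v
      map_add' := fun X Y => by rw [mat_add, Matrix.add_mulVec]
      map_smul' := fun c X => by rw [mat_smul, Matrix.smul_mulVec, RingHom.id_apply] }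

@[simp] theorem matMulVec_apply (i : Fin d) (v : CoIndex n i → ℝ) (X : Tensor n) :
    matMulVec i v X = mat i X *ᵥ v := rfl

/-- The velocity of a curve of matricizations of constant rank maps the kernel into the range. -/
theorem mulVec_mem_range_of_hasDerivAt {γ : ℝ → Tensor n} {Z : Tensor n}
    (h0 : γ 0 ∈ rankManifold n r) (hγ : ∀ᶠ s in 𝓝 (0 : ℝ), γ s ∈ rankManifold n r)
    (hZ : HasDerivAt γ Z 0) (i : Fin d) {v : CoIndex n i → ℝ} (hv : mat i (γ 0) *ᵥ v = 0) :
    mat i Z *ᵥ v ∈ LinearMap.range (mat i (γ 0)).mulVecLin := by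
  by_contra hw
  set M := LinearMap.range (mat i (γ 0)).mulVecLin with hM
  have hfin : Module.finrank ℝ M = r i := h0 i
  let b := Module.finBasisOfFinrankEq ℝ M hfin
  have hx : ∀ j, ∃ x, mat i (γ 0) *ᵥ x = (b j : Fin (n i) → ℝ) := fun j => by
    obtain ⟨x, hx⟩ := (b j).2
    exact ⟨x, hx⟩
  choose x hx using hx
  -- For `s ≠ 0` all these vectors lie in the range of `mat i (γ s)`. As `mat i (γ 0)` kills `v`,
  -- the `none` entry is a difference quotient, with limit `mat i Z *ᵥ v`. The limits are `r i + 1`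
  -- independent vectors if the claim fails, and independence is an open condition, which
  -- contradicts the rank `r i`.
  let f : ℝ → Option (Fin (r i)) → Fin (n i) → ℝ := fun s o =>
    o.elim (s⁻¹ • (mat i (γ s) *ᵥ v)) fun j => mat i (γ s) *ᵥ x j
  let f0 : Option (Fin (r i)) → Fin (n i) → ℝ := fun o => o.elim (mat i Z *ᵥ v) fun j => b j
  have hf : Filter.Tendsto f (𝓝[≠] 0) (𝓝 f0) := by
    rw [tendsto_pi_nhds]
    rintro (_ | j)
    · have h1 := ((matMulVec i v).hasFDerivAt.comp_hasDerivAt (0 : ℝ) hZ).tendsto_slope_zero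
      simpa [f, f0, hv] using h1
    · have h1 := ((matMulVec i (x j)).continuous.continuousAt.comp hZ.continuousAt).tendsto
      simp only [Function.comp, matMulVec_apply, hx] at h1
      exact h1.mono_left nhdsWithin_le_nhds
  have hli0 : LinearIndependent ℝ f0 := by
    have hb : LinearIndependent ℝ fun j => (b j : Fin (n i) → ℝ) :=
      b.linearIndependent.map' M.subtype M.ker_subtype
    refine linearIndependent_option.2 ⟨hb, fun hmem => hw ?_⟩
    refine (Submodule.span_le.2 ?_ : Submodule.span ℝ _ ≤ M) hmem
    rintro _ ⟨j, rfl⟩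
    exact (b j).2
  have hev := (hf.eventually hli0.eventually).and (hγ.filter_mono nhdsWithin_le_nhds)
  obtain ⟨s, hs, hsM⟩ := hev.exists
  have hle : Submodule.span ℝ (Set.range (f s)) ≤ LinearMap.range (mat i (γ s)).mulVecLin := by
    rw [Submodule.span_le]
    rintro _ ⟨_ | j, rfl⟩
    · exact Submodule.smul_mem _ _ ⟨v, rfl⟩
    · exact ⟨x j, rfl⟩
  have h1 := Submodule.finrank_mono hle
  rw [finrank_span_eq_card hs] at h1
  have h2 : Module.finrank ℝ (LinearMap.range (mat i (γ s)).mulVecLin) = r i := hsM i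
  rw [h2] at h1
  simp at h1

/-- Tangent vectors have no component that maps the kernel of a matricization to the complement
of its range. -/
theorem mul_mat_mul_eq_zero_of_mem_tangentSpace {X Z : Tensor n} (hX : X ∈ rankManifold n r)
    (hZ : Z ∈ tangentSpace r X) (i : Fin d) {P : Matrix (Fin (n i)) (Fin (n i)) ℝ}
    {N : Matrix (CoIndex n i) (CoIndex n i) ℝ} (hP : P * mat i X = 0) (hN : mat i X * N = 0) :
    P * mat i Z * N = 0 := by
  induction hZ using Submodule.span_induction with
  | mem Z hZ =>
    obtain ⟨γ, rfl, -, hγ, hZ⟩ := hZ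
    ext a c
    have hv : mat i (γ 0) *ᵥ (fun b => N b c) = 0 := by
      ext a'
      exact congrFun (congrFun hN a') c
    obtain ⟨u, hu⟩ := mulVec_mem_range_of_hasDerivAt hX hγ hZ i hv
    have h1 : P *ᵥ (mat i Z *ᵥ (fun b => N b c)) = 0 := by
      rw [← hu, Matrix.mulVecLin_apply, Matrix.mulVec_mulVec, hP, Matrix.zero_mulVec]
    rw [Matrix.mulVec_mulVec] at h1
    exact congrFun h1 a
  | zero =>
    have : mat i (0 : Tensor n) = 0 := rfl
    rw [this, Matrix.mul_zero, Matrix.zero_mul]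
  | add Y Z _ _ hY hZ => rw [mat_add, Matrix.mul_add, Matrix.add_mul, hY, hZ, add_zero]
  | smul c Z _ hZ => rw [mat_smul, Matrix.mul_smul, Matrix.smul_mul, hZ, smul_zero]

/-- The determinant is the characteristic polynomial of `-A` evaluated at `s`, which has only
finitely many roots. -/
theorem eventually_isUnit_add_smul_one {m : Type*} [Fintype m] [DecidableEq m]
    (A : Matrix m m ℝ) : ∀ᶠ s in 𝓝[≠] (0 : ℝ), IsUnit (A + s • (1 : Matrix m m ℝ)) := by
  have hne : (-A).charpoly ≠ 0 := (-A).charpoly_monic.ne_zero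
  have hfin : {s : ℝ | (-A).charpoly.IsRoot s}.Finite := Polynomial.finite_setOfPred_isRoot hne
  filter_upwards [nhdsNE_le_cofinite (0 : ℝ) hfin.compl_mem_cofinite] with s hs
  rw [Matrix.isUnit_iff_isUnit_det, isUnit_iff_ne_zero]
  intro h
  apply hs
  rw [Set.mem_ofPred_eq, Polynomial.IsRoot, Matrix.eval_charpoly, Matrix.scalar_apply,
    ← Matrix.smul_one_eq_diagonal, sub_neg_eq_add, add_comm, h]

/-- A matrix `B` of full row rank has a right inverse `N`, and `(A + s • B) * N = A * N + s • 1` is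
invertible for small `s ≠ 0`. -/
theorem eventually_rank_add_smul {k : ℕ} {ι : Type*} [Fintype ι] [DecidableEq ι]
    (A B : Matrix (Fin k) ι ℝ) (hB : B.rank = k) :
    ∀ᶠ s in 𝓝[≠] (0 : ℝ), (A + s • B).rank = k := by
  have hu : IsUnit (B * Bᵀ) := by
    rw [← Matrix.mulVec_surjective_iff_isUnit]
    refine (LinearMap.range_eq_top (f := (B * Bᵀ).mulVecLin)).1 ?_
    refine Submodule.eq_top_of_finrank_eq ?_
    rw [Module.finrank_fin_fun]
    exact (Matrix.rank_self_mul_transpose B).trans hB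
  have hBN : B * (Bᵀ * (B * Bᵀ)⁻¹) = 1 := by
    rw [← Matrix.mul_assoc, Matrix.mul_nonsing_inv _ ((Matrix.isUnit_iff_isUnit_det _).1 hu)]
  filter_upwards [eventually_isUnit_add_smul_one (A * (Bᵀ * (B * Bᵀ)⁻¹))] with s hs
  refine le_antisymm (by simpa using Matrix.rank_le_card_height (A + s • B)) ?_
  have h1 := Matrix.rank_mul_le_left (A + s • B) (Bᵀ * (B * Bᵀ)⁻¹)
  rw [Matrix.add_mul, Matrix.smul_mul, hBN, Matrix.rank_of_isUnit _ hs, Fintype.card_fin] at h1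
  exact h1

theorem continuous_tucker {S : Type*} [TopologicalSpace S] {C : S → Tensor r}
    {U : S → (i : Fin d) → Matrix (Fin (n i)) (Fin (r i)) ℝ} (hC : Continuous C)
    (hU : Continuous U) : Continuous fun s => tucker (C s) (U s) := by
  unfold tucker
  refine (PiLp.continuous_toLp 2 _).comp (continuous_pi fun k => ?_)
  refine continuous_finsetSum _ fun l _ => ?_
  refine Continuous.mul ?_ (continuous_finsetProd _ fun i _ => ?_)
  · fun_prop
  · exact (continuous_apply_apply (k i) (l i)).comp ((continuous_apply i).comp hU)

theorem continuous_mat (i : Fin d) : Continuous (mat (n := n) i) := by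
  refine continuous_matrix fun a b => ?_
  simp only [mat, Matrix.of_apply]
  fun_prop

theorem continuous_ten (i : Fin d) : Continuous (ten (n := n) i) := by
  refine (PiLp.continuous_toLp 2 _).comp (continuous_pi fun k => ?_)
  exact continuous_apply_apply _ _

/-- An unnormalized projection onto the orthogonal complement of the columns of `V`, which depends
polynomially on `V`. -/
def coProj {ι κ : Type*} [Fintype ι] [DecidableEq ι] [Fintype κ] [DecidableEq κ]
    (V : Matrix ι κ ℝ) : Matrix ι ι ℝ :=
  (Vᵀ * V).det • 1 - V * (Vᵀ * V).adjugate * Vᵀ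

section coProj

variable {ι κ : Type*} [Fintype ι] [DecidableEq ι] [Fintype κ] [DecidableEq κ]

theorem transpose_mul_coProj (V : Matrix ι κ ℝ) : Vᵀ * coProj V = 0 := by
  rw [coProj, Matrix.mul_sub, ← Matrix.mul_assoc, ← Matrix.mul_assoc, Matrix.mul_adjugate,
    Matrix.mul_smul, Matrix.smul_mul, Matrix.mul_one, Matrix.one_mul, sub_self]

theorem coProj_transpose (V : Matrix ι κ ℝ) : (coProj V)ᵀ = coProj V := by
  simp only [coProj, Matrix.transpose_sub, Matrix.transpose_smul, Matrix.transpose_one,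
    Matrix.transpose_mul, Matrix.transpose_transpose, Matrix.adjugate_transpose, Matrix.mul_assoc]

theorem coProj_of_orthonormal {V : Matrix ι κ ℝ} (h : Vᵀ * V = 1) : coProj V = 1 - V * Vᵀ := by
  simp [coProj, h]

theorem continuous_coProj : Continuous (coProj : Matrix ι κ ℝ → Matrix ι ι ℝ) := by
  unfold coProj
  fun_prop

end coProj

theorem transpose_mul_self_kronExcept_mul (i : Fin d)
    {U : (i : Fin d) → Matrix (Fin (n i)) (Fin (r i)) ℝ} (hU : ∀ j, (U j)ᵀ * U j = 1)
    {Q : Matrix (CoIndex r i) (Fin (r i)) ℝ} (hQ : Qᵀ * Q = 1) :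
    (kronExcept i U * Q)ᵀ * (kronExcept i U * Q) = 1 := by
  rw [Matrix.transpose_mul, Matrix.mul_assoc, ← Matrix.mul_assoc _ (kronExcept i U),
    kronExcept_transpose, kronExcept_mul]
  simp only [hU, kronExcept_one, Matrix.one_mul, hQ]

/-- A tensor with matricization `U1 * R1 * V0ᵀ`, where `V0 = (⨂_{j ≠ i} U0 j) Q`, is a limit of
tensors in the manifold whose matricizations have the same range and nearby co-ranges, provided
that there is some core of full multilinear rank. -/
theorem exists_approx_mem_rankManifold {H : Tensor r} (hH : ∀ j, (mat j H).rank = r j)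
    (i : Fin d) {U0 : (i : Fin d) → Matrix (Fin (n i)) (Fin (r i)) ℝ}
    (hU0 : ∀ j, (U0 j)ᵀ * U0 j = 1) (Q : Matrix (CoIndex r i) (Fin (r i)) ℝ)
    {U1 : Matrix (Fin (n i)) (Fin (r i)) ℝ} (hU1 : U1ᵀ * U1 = 1)
    (R1 : Matrix (Fin (r i)) (Fin (r i)) ℝ) :
    ∃ (X : ℝ → Tensor n) (V : ℝ → Matrix (CoIndex n i) (Fin (r i)) ℝ)
      (R : ℝ → Matrix (Fin (r i)) (Fin (r i)) ℝ), Continuous X ∧ Continuous V ∧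
      X 0 = ten i (U1 * R1 * (kronExcept i U0 * Q)ᵀ) ∧ V 0 = kronExcept i U0 * Q ∧
      (∀ s, mat i (X s) = U1 * R s * (V s)ᵀ) ∧
      ∀ᶠ s in 𝓝[≠] (0 : ℝ), X s ∈ rankManifold n r := by
  -- Two perturbations restore full rank for small `s ≠ 0`: the direction `H` acts on every
  -- matricization of the core, and `s • 1` makes the factor `R s` invertible, so that each `U s j`
  -- has a left inverse.
  let G : ℝ → Tensor r := fun s => ten i Qᵀ + s • H
  let R : ℝ → Matrix (Fin (r i)) (Fin (r i)) ℝ := fun s => R1 + s • 1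
  let U : ℝ → (j : Fin d) → Matrix (Fin (n j)) (Fin (r j)) ℝ :=
    fun s => Function.update U0 i (U1 * R s)
  let X : ℝ → Tensor n := fun s => tucker (G s) (U s)
  let V : ℝ → Matrix (CoIndex n i) (Fin (r i)) ℝ := fun s => kronExcept i U0 * (mat i (G s))ᵀ
  have hmatX : ∀ s, mat i (X s) = U1 * R s * (V s)ᵀ := by
    intro s
    have h1 : kronExcept i (U s) = kronExcept i U0 :=
      kronExcept_congr i fun j hj => Function.update_of_ne hj _ _
    simp only [X, V, mat_tucker, h1, Matrix.transpose_mul, Matrix.transpose_transpose,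
      Matrix.mul_assoc]
    simp only [U, Function.update_self, Matrix.mul_assoc]
  have hVz : V 0 = kronExcept i U0 * Q := by
    simp only [V, G, zero_smul, add_zero, mat_ten, Matrix.transpose_transpose]
  have hGc : Continuous G := by fun_prop
  have hRc : Continuous R := by fun_prop
  have hUc : Continuous U := continuous_const.update i (continuous_const.matrix_mul hRc)
  refine ⟨X, V, R, continuous_tucker hGc hUc,
    continuous_const.matrix_mul ((continuous_mat i).comp hGc).matrix_transpose,
    mat_injective i ?_, hVz, hmatX, ?_⟩
  · rw [hmatX, hVz, mat_ten]
    simp only [R, zero_smul, add_zero]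
  · have h1 : ∀ᶠ s in 𝓝[≠] (0 : ℝ), ∀ j, (mat j (G s)).rank = r j :=
      Filter.eventually_all.2 fun j => eventually_rank_add_smul _ _ (hH j)
    filter_upwards [h1, eventually_isUnit_add_smul_one R1] with s hs hRs j
    rw [← hs j]
    refine rank_mat_tucker_eq j (G s)
      (W := Function.update (fun j => (U0 j)ᵀ) i ((R s)⁻¹ * U1ᵀ)) fun l => ?_
    by_cases hl : l = i
    · subst hl
      simp only [U, Function.update_self]
      rw [Matrix.mul_assoc, ← Matrix.mul_assoc U1ᵀ, hU1, Matrix.one_mul,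
        Matrix.nonsing_inv_mul _ ((Matrix.isUnit_iff_isUnit_det _).1 hRs)]
    · simp only [U, Function.update_of_ne hl, hU0]

section Projections

variable {ι κ : Type*} [Fintype κ] {V : Matrix ι κ ℝ}

theorem mul_transpose_symm (V : Matrix ι κ ℝ) : (V * Vᵀ)ᵀ = V * Vᵀ := by simp

theorem mul_transpose_idem [Fintype ι] [DecidableEq κ] (h : Vᵀ * V = 1) : V * Vᵀ * (V * Vᵀ) = V * Vᵀ := by
  rw [Matrix.mul_assoc, ← Matrix.mul_assoc Vᵀ, h, Matrix.one_mul]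

theorem one_sub_mul_transpose_symm [DecidableEq ι] (V : Matrix ι κ ℝ) :
    (1 - V * Vᵀ)ᵀ = 1 - V * Vᵀ := by simp

theorem one_sub_mul_transpose_mul [Fintype ι] [DecidableEq ι] [DecidableEq κ]
    (h : Vᵀ * V = 1) : (1 - V * Vᵀ) * V = 0 := by
  rw [Matrix.sub_mul, Matrix.mul_assoc, h, Matrix.one_mul, Matrix.mul_one, sub_self]

theorem one_sub_mul_transpose_idem [Fintype ι] [DecidableEq ι] [DecidableEq κ]
    (h : Vᵀ * V = 1) :
    (1 - V * Vᵀ) * (1 - V * Vᵀ) = 1 - V * Vᵀ := by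
  rw [Matrix.mul_sub (1 - V * Vᵀ) 1, ← Matrix.mul_assoc, one_sub_mul_transpose_mul h,
    Matrix.zero_mul, Matrix.mul_one, sub_zero]

end Projections

/-- A vector field whose normal part is at most `ε` has at most the component `ε ‖Z‖` in any
direction `Z` that vanishes on the tangent space. -/
theorem inner_sandwich_le_of_normal_part_le (i : Fin d) {X : Tensor n}
    (hX : X ∈ rankManifold n r) {P : Matrix (Fin (n i)) (Fin (n i)) ℝ}
    {N : Matrix (CoIndex n i) (CoIndex n i) ℝ} (hPt : Pᵀ = P) (hNt : Nᵀ = N)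
    (hP : P * mat i X = 0) (hN : mat i X * N = 0) {f : Tensor n} {ε : ℝ}
    (hε : ‖f - tangentProj r X f‖ ≤ ε) (g : Tensor n) :
    inner ℝ f (sandwich i P N g) ≤ ε * ‖sandwich i P N g‖ := by
  have hZ : tangentProj r X f ∈ tangentSpace r X := Submodule.starProjection_apply_mem _ _
  have h0 : inner ℝ (tangentProj r X f) (sandwich i P N g) = 0 := by
    have h1 : ten i (0 : Matrix (Fin (n i)) (CoIndex n i) ℝ) = 0 := rfl
    rw [real_inner_comm, inner_sandwich_left, hPt, hNt, sandwich_apply,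
      mul_mat_mul_eq_zero_of_mem_tangentSpace hX hZ i hP hN, h1, inner_zero_right]
  rw [← sub_zero (inner ℝ f _), ← h0, ← inner_sub_left]
  exact (real_inner_le_norm _ _).trans (mul_le_mul_of_nonneg_right hε (norm_nonneg _))

/-- Let `X` have an `i`-mode matricization with range in the span of the columns of `U1` and
co-range in the span of the columns of `V0 = (⨂_{j ≠ i} U0 j) Q`. If a continuous vector field has
an `ε`-small normal part at the points of the manifold near `X`, then the doubly projected part of
its `i`-mode matricization at `X` is `ε`-small. The point `X` itself may have lower rank. -/
theorem norm_sandwich_le_of_normal_part_le {H : Tensor r} (hH : ∀ j, (mat j H).rank = r j)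
    (i : Fin d) {U0 : (i : Fin d) → Matrix (Fin (n i)) (Fin (r i)) ℝ}
    (hU0 : ∀ j, (U0 j)ᵀ * U0 j = 1) {Q : Matrix (CoIndex r i) (Fin (r i)) ℝ} (hQ : Qᵀ * Q = 1)
    {V0 : Matrix (CoIndex n i) (Fin (r i)) ℝ} (hV0 : V0 = kronExcept i U0 * Q)
    {U1 : Matrix (Fin (n i)) (Fin (r i)) ℝ} (hU1 : U1ᵀ * U1 = 1)
    (R1 : Matrix (Fin (r i)) (Fin (r i)) ℝ) {f : Tensor n → Tensor n} (hf : Continuous f) {ε : ℝ}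
    (hε : ∀ᶠ X in 𝓝 (ten i (U1 * R1 * V0ᵀ)), X ∈ rankManifold n r →
      ‖f X - tangentProj r X (f X)‖ ≤ ε) :
    ‖sandwich i (1 - U1 * U1ᵀ) (1 - V0 * V0ᵀ) (f (ten i (U1 * R1 * V0ᵀ)))‖ ≤ ε := by
  have hVo : V0ᵀ * V0 = 1 := hV0 ▸ transpose_mul_self_kronExcept_mul i hU0 hQ
  obtain ⟨X, V, R, hXc, hVc, hXz, hVz, hmatX, hXM⟩ :=
    exists_approx_mem_rankManifold hH i hU0 Q hU1 R1
  rw [← hV0] at hXz hVz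
  rw [← hXz] at hε ⊢
  have hev := hXM.and ((hXc.continuousAt.eventually hε).filter_mono nhdsWithin_le_nhds)
  -- The columns of `V s` need not be orthonormal for `s ≠ 0`. The matrix `coProj (V s)` is still
  -- symmetric and annihilated by `(V s)ᵀ`, is continuous in `s`, and equals `1 - V0 * V0ᵀ` at `s =
  -- 0`.
  have hineq : ∀ᶠ s in 𝓝[≠] (0 : ℝ),
      inner ℝ (f (X s)) (sandwich i (1 - U1 * U1ᵀ) (coProj (V s)) (f (X 0))) ≤
        ε * ‖sandwich i (1 - U1 * U1ᵀ) (coProj (V s)) (f (X 0))‖ := by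
    filter_upwards [hev] with s hs
    refine inner_sandwich_le_of_normal_part_le i hs.1 (one_sub_mul_transpose_symm U1)
      (coProj_transpose _) ?_ ?_ (hs.2 hs.1) _
    · rw [hmatX, ← Matrix.mul_assoc, ← Matrix.mul_assoc, one_sub_mul_transpose_mul hU1,
        Matrix.zero_mul, Matrix.zero_mul]
    · rw [hmatX, Matrix.mul_assoc, transpose_mul_coProj, Matrix.mul_zero]
  have hSc : Continuous fun s => sandwich i (1 - U1 * U1ᵀ) (coProj (V s)) (f (X 0)) := by
    simp only [sandwich_apply]
    exact (continuous_ten i).comp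
      (continuous_const.matrix_mul (continuous_coProj.comp hVc))
  have hlim := le_of_tendsto_of_tendsto
    (((hf.comp hXc).inner hSc).continuousAt.tendsto.mono_left nhdsWithin_le_nhds)
    ((continuous_const.mul hSc.norm).continuousAt.tendsto.mono_left nhdsWithin_le_nhds) hineq
  simp only [Function.comp, Pi.mul_apply, hVz, coProj_of_orthonormal hVo] at hlim
  -- In the limit the test direction is an orthogonal projection of `f (X 0)`, so the inner product
  -- is the squared norm and one factor cancels.
  have hself := inner_sandwich_left i (1 - U1 * U1ᵀ) (1 - V0 * V0ᵀ) (f (X 0))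
    (sandwich i (1 - U1 * U1ᵀ) (1 - V0 * V0ᵀ) (f (X 0)))
  rw [sandwich_sandwich, one_sub_mul_transpose_symm, one_sub_mul_transpose_symm,
    one_sub_mul_transpose_idem hU1, one_sub_mul_transpose_idem hVo,
    real_inner_self_eq_norm_mul_norm] at hself
  rw [← hself] at hlim
  obtain ⟨s, hs, hs2⟩ := hev.exists
  have hε0 : 0 ≤ ε := (norm_nonneg _).trans (hs2 hs)
  rcases (norm_nonneg
    (sandwich i (1 - U1 * U1ᵀ) (1 - V0 * V0ᵀ) (f (X 0)))).eq_or_lt with h0 | h0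
  · rw [← h0]; exact hε0
  · exact le_of_mul_le_mul_right hlim h0

end Normal

/-! ### Local error of one step. -/

section LocalError

variable {d : ℕ} {r n : Fin d → ℕ}

theorem hasDerivWithinAt_tensor {f : ℝ → Tensor n} {f' : Tensor n} {s : Set ℝ} {x : ℝ}
    (h : ∀ k, HasDerivWithinAt (fun t => f t k) (f' k) s x) : HasDerivWithinAt f f' s x :=
  (PiLp.continuousLinearEquiv 2 ℝ
    fun _ : ((i : Fin d) → Fin (n i)) => ℝ).symm.hasFDerivAt.comp_hasDerivWithinAt x
      (hasDerivWithinAt_pi.2 h)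

/-- The differential equation for the factor `K` in a basis update, in terms of the tensor with
matricization `K * V0ᵀ`. -/
theorem hasDerivWithinAt_ten_mul_transpose (i : Fin d) {K : ℝ → Matrix (Fin (n i)) (Fin (r i)) ℝ}
    (V0 : Matrix (CoIndex n i) (Fin (r i)) ℝ) {G : Tensor n} {s : Set ℝ} {t : ℝ}
    (hK : ∀ a b, HasDerivWithinAt (fun s => K s a b) ((mat i G * V0) a b) s t) :
    HasDerivWithinAt (fun s => ten i (K s * V0ᵀ)) (sandwich i 1 (V0 * V0ᵀ) G) s t := by
  refine hasDerivWithinAt_tensor fun k => ?_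
  rw [sandwich_apply, Matrix.one_mul, ← Matrix.mul_assoc]
  simp only [ten, Matrix.mul_apply (M := K _), Matrix.mul_apply (M := mat i G * V0)]
  exact HasDerivWithinAt.fun_sum fun b _ => (hK _ b).mul_const _

/-- Meant for `X`, `Y`, `Z` equal to `F t` at `A t`, `W t` and `W t1`. The first two terms are then
Lipschitz differences; in the third, `F t` is evaluated at the one point whose range `P`
annihilates. -/
theorem sandwich_one_right_sub_sandwich_one_left (i : Fin d)
    (P : Matrix (Fin (n i)) (Fin (n i)) ℝ) (N : Matrix (CoIndex n i) (CoIndex n i) ℝ)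
    (X Y Z : Tensor n) :
    sandwich i P 1 (X - sandwich i 1 N Y) =
      sandwich i P N (X - Y) + sandwich i P (1 - N) (X - Z) + sandwich i P (1 - N) Z := by
  apply mat_injective i
  simp only [mat_sandwich, mat_sub, mat_add, Matrix.mul_sub, Matrix.sub_mul, Matrix.mul_one,
    Matrix.one_mul, ← Matrix.mul_assoc]
  abel

/-- The range of the updated basis in mode `i` captures the `i`-mode matricization of the starting
value plus the increment of the exact solution up to a defect of second order in the step size, up
to multiples of the current error and of the normal part of the vector field. -/
theorem IsBasisUpdate.mode_defect_le {H : Tensor r} (hH : ∀ j, (mat j H).rank = r j)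
    {F : ℝ → Tensor n → Tensor n} {A : ℝ → Tensor n} {t0 t1 L B ε ρ : ℝ} (ht : t0 ≤ t1)
    (hL0 : 0 ≤ L)
    (hA : ∀ t ∈ Set.Icc t0 t1, HasDerivWithinAt A (F t (A t)) (Set.Icc t0 t1) t)
    (hL : ∀ t ∈ Set.Icc t0 t1, ∀ X X', ‖F t X - F t X'‖ ≤ L * ‖X - X'‖)
    (hB : ∀ t ∈ Set.Icc t0 t1, ∀ X, ‖F t X‖ ≤ B)
    (hε : ∀ t ∈ Set.Icc t0 t1, ∀ X ∈ rankManifold n r, ‖X - A t‖ < ρ →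
      ‖F t X - tangentProj r X (F t X)‖ ≤ ε)
    {C0 : Tensor r} {U0 : (i : Fin d) → Matrix (Fin (n i)) (Fin (r i)) ℝ}
    (hU0 : ∀ j, (U0 j)ᵀ * U0 j = 1)
    (hρ : ‖tucker C0 U0 - A t0‖ + 2 * B * (t1 - t0) < ρ) {i : Fin d}
    {U1 : Matrix (Fin (n i)) (Fin (r i)) ℝ} (hU : IsBasisUpdate F t0 t1 C0 U0 i U1) :
    U1ᵀ * U1 = 1 ∧ ‖sandwich i (1 - U1 * U1ᵀ) 1 (tucker C0 U0 + (A t1 - A t0))‖ ≤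
      (2 * L * (‖tucker C0 U0 - A t0‖ + 2 * B * (t1 - t0)) + ε) * (t1 - t0) := by
  obtain ⟨Q, S0, R1, V0, K, ⟨hQ, -, hC0⟩, hV0, hK0, hK, hU1, -, hK1⟩ := hU
  have hVo : V0ᵀ * V0 = 1 := hV0 ▸ transpose_mul_self_kronExcept_mul i hU0 hQ
  refine ⟨hU1, ?_⟩
  have ht0 : t0 ∈ Set.Icc t0 t1 := ⟨le_rfl, ht⟩
  have ht1 : t1 ∈ Set.Icc t0 t1 := ⟨ht, le_rfl⟩
  have hB0 : 0 ≤ B := (norm_nonneg _).trans (hB t0 ht0 0)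
  set Y0 := tucker C0 U0 with hY0
  set W : ℝ → Tensor n := fun t => ten i (K t * V0ᵀ) with hW
  have hW' : ∀ t ∈ Set.Icc t0 t1,
      HasDerivWithinAt W (sandwich i 1 (V0 * V0ᵀ) (F t (W t))) (Set.Icc t0 t1) t := fun t ht =>
    hasDerivWithinAt_ten_mul_transpose i V0 (hK t ht)
  have hW0 : W t0 = Y0 := by
    have h1 : mat i C0 = S0 * Qᵀ := by
      rw [← Matrix.transpose_transpose (mat i C0), hC0, Matrix.transpose_mul,
        Matrix.transpose_transpose]
    apply mat_injective i
    rw [hW, hY0, mat_ten, mat_tucker, hK0, hV0, h1, Matrix.transpose_mul]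
    simp only [Matrix.mul_assoc]
  have hbound : ∀ t ∈ Set.Icc t0 t1, B * (t - t0) ≤ B * (t1 - t0) := fun t ht =>
    mul_le_mul_of_nonneg_left (by linarith [ht.2]) hB0
  have hWB : ∀ t ∈ Set.Icc t0 t1, ‖W t - Y0‖ ≤ B * (t1 - t0) := fun t ht => by
    rw [← hW0]
    refine (norm_image_sub_le_of_norm_deriv_le_segment' hW' (fun s hs => ?_) t ht).trans
      (hbound t ht)
    have hs' := Set.Ico_subset_Icc_self hs
    exact (norm_sandwich_le i Matrix.transpose_one (Matrix.one_mul 1) (mul_transpose_symm V0)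
      (mul_transpose_idem hVo) _).trans (hB s hs' _)
  have hAB : ∀ t ∈ Set.Icc t0 t1, ‖A t - A t0‖ ≤ B * (t1 - t0) := fun t ht =>
    (norm_image_sub_le_of_norm_deriv_le_segment' hA
      (fun s hs => hB s (Set.Ico_subset_Icc_self hs) _) t ht).trans (hbound t ht)
  -- The two times are independent because `W` frozen at `t1` is compared with `A t` for every `t`.
  have hAW : ∀ s ∈ Set.Icc t0 t1, ∀ t ∈ Set.Icc t0 t1,
      ‖W s - A t‖ ≤ ‖Y0 - A t0‖ + 2 * B * (t1 - t0) := fun s hs t ht => by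
    have h1 : W s - A t = (W s - Y0) + (Y0 - A t0) - (A t - A t0) := by abel
    have h2 := norm_sub_le ((W s - Y0) + (Y0 - A t0)) (A t - A t0)
    have h3 := norm_add_le (W s - Y0) (Y0 - A t0)
    rw [h1]
    linarith [hWB s hs, hAB t ht]
  set P := 1 - U1 * U1ᵀ with hPdef
  have hP : Pᵀ = P := one_sub_mul_transpose_symm U1
  have hP2 : P * P = P := one_sub_mul_transpose_idem hU1
  have hW1 : W t1 = ten i (U1 * R1 * V0ᵀ) := by simp only [hW, hK1]
  have hPW1 : sandwich i P 1 (W t1) = 0 := by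
    apply mat_injective i
    rw [mat_sandwich, hW1, mat_ten, Matrix.mul_one, ← Matrix.mul_assoc, ← Matrix.mul_assoc,
      one_sub_mul_transpose_mul hU1, Matrix.zero_mul, Matrix.zero_mul]
    rfl
  have hnormal : ∀ t ∈ Set.Icc t0 t1, ‖sandwich i P (1 - V0 * V0ᵀ) (F t (W t1))‖ ≤ ε := by
    intro t ht
    have hcont : Continuous (F t) :=
      (LipschitzWith.of_dist_le_mul (K := ⟨L, hL0⟩) fun X X' => by
        rw [dist_eq_norm, dist_eq_norm]; exact hL t ht X X').continuous
    have hev : ∀ᶠ X in 𝓝 (W t1), ‖X - A t‖ < ρ :=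
      (continuous_id.sub continuous_const).norm.continuousAt.eventually_lt_const
        ((hAW t1 ht1 t ht).trans_lt hρ)
    rw [hW1] at hev ⊢
    exact norm_sandwich_le_of_normal_part_le hH i hU0 hQ hV0 hU1 R1 hcont
      (hev.mono fun X hX hXM => hε t ht X hXM hX)
  have hg : ∀ t ∈ Set.Icc t0 t1, HasDerivWithinAt (fun t => sandwich i P 1 (A t - W t))
      (sandwich i P 1 (F t (A t) - sandwich i 1 (V0 * V0ᵀ) (F t (W t)))) (Set.Icc t0 t1) t :=
    fun t ht => (sandwich i P 1).hasFDerivAt.comp_hasDerivWithinAt t ((hA t ht).sub (hW' t ht))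
  have hgb := norm_image_sub_le_of_norm_deriv_le_segment' hg
    (C := 2 * L * (‖Y0 - A t0‖ + 2 * B * (t1 - t0)) + ε) (fun t ht => ?_) t1 ht1
  -- Subtracting `W t1` is free since `P` annihilates it; what remains is an increment of `A - W`.
  · have h1 : sandwich i P 1 (Y0 + (A t1 - A t0)) =
        sandwich i P 1 (A t1 - W t1) - sandwich i P 1 (A t0 - W t0) := by
      rw [hW0, ← map_sub, ← add_zero (sandwich i P 1 (A t1 - W t1 - (A t0 - Y0))), ← hPW1,
        ← map_add]
      congr 1
      abel
    rw [h1]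
    exact hgb
  · have ht' := Set.Ico_subset_Icc_self ht
    have hlip : ∀ s ∈ Set.Icc t0 t1,
        ‖F t (A t) - F t (W s)‖ ≤ L * (‖Y0 - A t0‖ + 2 * B * (t1 - t0)) := fun s hs => by
      refine (hL t ht' _ _).trans (mul_le_mul_of_nonneg_left ?_ hL0)
      rw [norm_sub_rev]
      exact hAW s hs t ht'
    rw [sandwich_one_right_sub_sandwich_one_left i P (V0 * V0ᵀ) _ _ (F t (W t1))]
    have h1 := (norm_sandwich_le i hP hP2 (mul_transpose_symm V0) (mul_transpose_idem hVo)
      (F t (A t) - F t (W t))).trans (hlip t ht')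
    have h2 := (norm_sandwich_le i hP hP2 (one_sub_mul_transpose_symm V0)
      (one_sub_mul_transpose_idem hVo) (F t (A t) - F t (W t1))).trans (hlip t1 ht1)
    refine norm_add₃_le.trans ?_
    linarith [hnormal t ht']

/-- The error of one step, relative to the starting value plus the increment of the exact
solution. -/
theorem IsStep.local_error_le {H : Tensor r} (hH : ∀ j, (mat j H).rank = r j)
    {F : ℝ → Tensor n → Tensor n} {A : ℝ → Tensor n} {t0 t1 L B ε ρ : ℝ} (ht : t0 ≤ t1)
    (hL0 : 0 ≤ L)
    (hA : ∀ t ∈ Set.Icc t0 t1, HasDerivWithinAt A (F t (A t)) (Set.Icc t0 t1) t)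
    (hL : ∀ t ∈ Set.Icc t0 t1, ∀ X X', ‖F t X - F t X'‖ ≤ L * ‖X - X'‖)
    (hB : ∀ t ∈ Set.Icc t0 t1, ∀ X, ‖F t X‖ ≤ B)
    (hε : ∀ t ∈ Set.Icc t0 t1, ∀ X ∈ rankManifold n r, ‖X - A t‖ < ρ →
      ‖F t X - tangentProj r X (F t X)‖ ≤ ε)
    {Y0 Y1 : Tensor n} (hρ : ‖Y0 - A t0‖ + 2 * B * (t1 - t0) < ρ)
    (hY : IsStep r F t0 t1 Y0 Y1) {θ : ℝ}
    (hθ : θ = d * ((2 * L * (‖Y0 - A t0‖ + 2 * B * (t1 - t0)) + ε) * (t1 - t0))) :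
    ‖Y1 - (Y0 + (A t1 - A t0))‖ ≤
      θ + L * (4 * B * (t1 - t0) + θ + ‖Y0 - A t0‖) * (t1 - t0) := by
  obtain ⟨C0, C1, U0, U1, hU0, rfl, hbasis, ⟨C, hC0, hC, rfl⟩, rfl⟩ := hY
  have hmode := fun i => (hbasis i).mode_defect_le hH ht hL0 hA hL hB hε hU0 hρ
  have ht0 : t0 ∈ Set.Icc t0 t1 := ⟨le_rfl, ht⟩
  have ht1 : t1 ∈ Set.Icc t0 t1 := ⟨ht, le_rfl⟩
  have hB0 : 0 ≤ B := (norm_nonneg _).trans (hB t0 ht0 0)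
  set Y0 := tucker C0 U0 with hY0
  set P : (i : Fin d) → Matrix (Fin (n i)) (Fin (n i)) ℝ := fun i => U1 i * (U1 i)ᵀ with hPdef
  have hP : ∀ i, (P i)ᵀ = P i := fun i => mul_transpose_symm (U1 i)
  have hP2 : ∀ i, P i * P i = P i := fun i => mul_transpose_idem (hmode i).1
  set E := Y0 + (A t1 - A t0) with hE
  have hPE : ‖E - tuckerCLM P E‖ ≤ θ := by
    refine (norm_sub_tucker_le hP hP2 E).trans ?_
    refine (Finset.sum_le_sum fun i _ => (hmode i).2).trans ?_
    rw [hθ, Finset.sum_const, Finset.card_univ, Fintype.card_fin, nsmul_eq_mul]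
  set Z : ℝ → Tensor n := fun t => tucker (C t) U1 with hZ
  have hZ' : ∀ t ∈ Set.Icc t0 t1,
      HasDerivWithinAt Z (tuckerCLM P (F t (Z t))) (Set.Icc t0 t1) t := fun t ht => by
    have h1 := (tuckerCLM U1).hasFDerivAt.comp_hasDerivWithinAt t (hC t ht)
    simp only [tuckerCLM_apply, tucker_tucker] at h1
    exact h1
  have hZ0 : Z t0 = tuckerCLM P Y0 := by
    simp only [hZ, hC0, hY0, tuckerCLM_apply, tucker_tucker, hPdef, Matrix.mul_assoc]
  have hbound : ∀ t ∈ Set.Icc t0 t1, B * (t - t0) ≤ B * (t1 - t0) := fun t ht =>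
    mul_le_mul_of_nonneg_left (by linarith [ht.2]) hB0
  have hZB : ∀ t ∈ Set.Icc t0 t1, ‖Z t - Z t0‖ ≤ B * (t1 - t0) := fun t ht =>
    (norm_image_sub_le_of_norm_deriv_le_segment' hZ' (fun s hs =>
      (norm_tucker_le hP hP2 _).trans (hB s (Set.Ico_subset_Icc_self hs) _)) t ht).trans
      (hbound t ht)
  have hAB : ∀ t ∈ Set.Icc t0 t1, ‖A t - A t0‖ ≤ B * (t1 - t0) := fun t ht =>
    (norm_image_sub_le_of_norm_deriv_le_segment' hA
      (fun s hs => hB s (Set.Ico_subset_Icc_self hs) _) t ht).trans (hbound t ht)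
  -- The new bases need not contain the old ones, but they nearly capture `E`, and `Y0` differs from
  -- `E` only by the increment of `A`.
  have hPY0 : ‖tuckerCLM P Y0 - Y0‖ ≤ 2 * (B * (t1 - t0)) + θ := by
    have h1 : tuckerCLM P Y0 - Y0 =
        (A t1 - A t0) - tuckerCLM P (A t1 - A t0) - (E - tuckerCLM P E) := by
      rw [hE, map_add]; abel
    have h2 := norm_sub_le ((A t1 - A t0) - tuckerCLM P (A t1 - A t0)) (E - tuckerCLM P E)
    have h3 := norm_sub_le (A t1 - A t0) (tuckerCLM P (A t1 - A t0))
    have h4 : ‖tuckerCLM P (A t1 - A t0)‖ ≤ ‖A t1 - A t0‖ := norm_tucker_le hP hP2 _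
    rw [h1]
    linarith [hAB t1 ht1]
  have hZA : ∀ t ∈ Set.Icc t0 t1, ‖Z t - A t‖ ≤ 4 * B * (t1 - t0) + θ + ‖Y0 - A t0‖ :=
    fun t ht => by
      have h1 : Z t - A t =
          (Z t - Z t0) + (tuckerCLM P Y0 - Y0) + (Y0 - A t0) - (A t - A t0) := by
        rw [hZ0]; abel
      rw [h1]
      refine (norm_sub_le _ _).trans ?_
      linarith [norm_add₃_le (a := Z t - Z t0) (b := tuckerCLM P Y0 - Y0) (c := Y0 - A t0),
        hZB t ht, hAB t ht]
  have hg : ∀ t ∈ Set.Icc t0 t1, HasDerivWithinAt (fun t => Z t - tuckerCLM P (A t))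
      (tuckerCLM P (F t (Z t)) - tuckerCLM P (F t (A t))) (Set.Icc t0 t1) t := fun t ht =>
    (hZ' t ht).sub ((tuckerCLM P).hasFDerivAt.comp_hasDerivWithinAt t (hA t ht))
  have hgb := norm_image_sub_le_of_norm_deriv_le_segment' hg
    (C := L * (4 * B * (t1 - t0) + θ + ‖Y0 - A t0‖)) (fun t ht => ?_) t1 ht1
  · have h1 : Z t1 - E = (Z t1 - tuckerCLM P (A t1) - (Z t0 - tuckerCLM P (A t0))) -
        (E - tuckerCLM P E) := by
      rw [hZ0, hE, map_add, map_sub]; abel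
    change ‖Z t1 - E‖ ≤ _
    rw [h1]
    refine (norm_sub_le _ _).trans ?_
    linarith
  · have ht' := Set.Ico_subset_Icc_self ht
    rw [← map_sub]
    refine (norm_tucker_le hP hP2 _).trans ((hL t ht' _ _).trans ?_)
    exact mul_le_mul_of_nonneg_left (hZA t ht') hL0

/-- Not every `r` is the multilinear rank of a core. The witness comes from a starting value in the
manifold and then serves all steps, as later iterates may lose rank. -/
theorem IsStep.exists_full_rank_core {F : ℝ → Tensor n → Tensor n} {t0 t1 : ℝ} {Y0 Y1 : Tensor n}
    (hY : IsStep r F t0 t1 Y0 Y1) (h0 : Y0 ∈ rankManifold n r) :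
    ∃ H : Tensor r, ∀ j, (mat j H).rank = r j := by
  obtain ⟨C0, -, U0, -, -, rfl, -⟩ := hY
  refine ⟨C0, fun j => le_antisymm ?_ ?_⟩
  · simpa using Matrix.rank_le_card_height (mat j C0)
  · exact (h0 j).symm.le.trans (rank_mat_tucker_le j C0 U0)

/-- One step of a discrete Gronwall inequality. -/
theorem gronwall_step_le {a h t e δ β : ℝ} (ha : 0 ≤ a) (hh : 0 ≤ h) (ht : 0 ≤ t) (hβ : 0 ≤ β)
    (he0 : 0 ≤ e) (he : e ≤ Real.exp (a * t) * (δ + t * β)) :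
    (1 + a * h) * e + h * β ≤ Real.exp (a * (t + h)) * (δ + (t + h) * β) := by
  have h1 : 1 + a * h ≤ Real.exp (a * h) := by linarith [Real.add_one_le_exp (a * h)]
  have h2 : h * β ≤ Real.exp (a * (t + h)) * (h * β) :=
    le_mul_of_one_le_left (by positivity) (Real.one_le_exp (by positivity))
  have h4 : (1 + a * h) * e ≤ Real.exp (a * h) * (Real.exp (a * t) * (δ + t * β)) :=
    mul_le_mul h1 he he0 (Real.exp_pos _).le
  have h5 : Real.exp (a * (t + h)) = Real.exp (a * h) * Real.exp (a * t) := by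
    rw [← Real.exp_add]; ring_nf
  rw [h5] at h2 ⊢
  linarith

end LocalError

/-- The propagation of the error in one step, with the constants made explicit. -/
theorem IsStep.error_propagation_le {d : ℕ} {r n : Fin d → ℕ} {H : Tensor r}
    (hH : ∀ j, (mat j H).rank = r j)
    {F : ℝ → Tensor n → Tensor n} {A : ℝ → Tensor n} {t0 t1 L B T ε ρ : ℝ} (ht : t0 ≤ t1)
    (hT : t1 - t0 ≤ T) (hL0 : 0 ≤ L) (hε0 : 0 ≤ ε)
    (hA : ∀ t ∈ Set.Icc t0 t1, HasDerivWithinAt A (F t (A t)) (Set.Icc t0 t1) t)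
    (hL : ∀ t ∈ Set.Icc t0 t1, ∀ X X', ‖F t X - F t X'‖ ≤ L * ‖X - X'‖)
    (hB : ∀ t ∈ Set.Icc t0 t1, ∀ X, ‖F t X‖ ≤ B)
    (hε : ∀ t ∈ Set.Icc t0 t1, ∀ X ∈ rankManifold n r, ‖X - A t‖ < ρ →
      ‖F t X - tangentProj r X (F t X)‖ ≤ ε)
    {Y0 Y1 : Tensor n} (hρ : ‖Y0 - A t0‖ + 2 * B * (t1 - t0) < ρ)
    (hY : IsStep r F t0 t1 Y0 Y1) :
    ‖Y1 - A t1‖ ≤ (1 + (2 * L * (d * (1 + L * T)) + L) * (t1 - t0)) * ‖Y0 - A t0‖ +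
      (t1 - t0) * (d * (1 + L * T) * ε +
        (4 * L * B * (d * (1 + L * T)) + 4 * L * B) * (t1 - t0)) := by
  have hB0 : 0 ≤ B := (norm_nonneg _).trans (hB t0 ⟨le_rfl, ht⟩ 0)
  have hloc := hY.local_error_le hH ht hL0 hA hL hB hε hρ rfl
  have h1 : Y1 - A t1 = (Y1 - (Y0 + (A t1 - A t0))) + (Y0 - A t0) := by abel
  have h2 := norm_add_le (Y1 - (Y0 + (A t1 - A t0))) (Y0 - A t0)
  rw [← h1] at h2
  set e := ‖Y0 - A t0‖
  have he : 0 ≤ e := norm_nonneg _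
  set h := t1 - t0
  have hh : 0 ≤ h := sub_nonneg.2 ht
  set θ := d * ((2 * L * (e + 2 * B * h) + ε) * h) with hθ
  have hθ0 : 0 ≤ θ := by positivity
  -- The feedback of the mode defect through the core flow is absorbed by `h ≤ T`, which produces
  -- the factor `1 + L * T`.
  have h3 : L * θ * h ≤ L * θ * T := mul_le_mul_of_nonneg_left hT (by positivity)
  have h4 : θ + L * θ * T = (d * (1 + L * T)) * ((2 * L * (e + 2 * B * h) + ε) * h) := by
    rw [hθ]; ring
  linarith

end TuckerIntegrator

end

/-! ### Global error: accumulation over the steps. -/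

theorem theorem7 (d : ℕ) (L B T : ℝ) :
    ∃ c₀ c₁ c₂ : ℝ, 0 ≤ c₀ ∧ 0 ≤ c₁ ∧ 0 ≤ c₂ ∧
      ∀ (n r : Fin d → ℕ)
        (F : ℝ → TuckerIntegrator.Tensor n → TuckerIntegrator.Tensor n)
        (A : ℝ → TuckerIntegrator.Tensor n) (Y : ℕ → TuckerIntegrator.Tensor n)
        (ε δ h ρ : ℝ),
        -- `A` solves the full differential equation on `[0, T]`
        (∀ t ∈ Set.Icc 0 T, HasDerivWithinAt A (F t (A t)) (Set.Icc 0 T) t) →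
        -- `F` is Lipschitz continuous and bounded
        (∀ t ∈ Set.Icc 0 T, ∀ X X', ‖F t X - F t X'‖ ≤ L * ‖X - X'‖) →
        (∀ t ∈ Set.Icc 0 T, ∀ X, ‖F t X‖ ≤ B) →
        -- the non-tangential part is `ε`-small in the `ρ`-neighbourhood of the solution
        0 ≤ ε → 0 < ρ →
        (∀ t ∈ Set.Icc 0 T, ∀ X ∈ TuckerIntegrator.rankManifold n r, ‖X - A t‖ < ρ →
          ‖F t X - TuckerIntegrator.tangentProj r X (F t X)‖ ≤ ε) →
        -- the initial error is `δ`-small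
        Y 0 ∈ TuckerIntegrator.rankManifold n r →
        ‖Y 0 - A 0‖ ≤ δ →
        -- `Y` is produced by the integrator with step size `h`
        0 < h →
        (∀ k : ℕ, ((k : ℝ) + 1) * h ≤ T →
          TuckerIntegrator.IsStep r F ((k : ℝ) * h) (((k : ℝ) + 1) * h) (Y k) (Y (k + 1))) →
        -- the neighbourhood is not smaller than the error bound
        c₀ * δ + c₁ * ε + c₂ * h ≤ ρ →
        ∀ k : ℕ, (k : ℝ) * h ≤ T → ‖Y k - A ((k : ℝ) * h)‖ ≤ c₀ * δ + c₁ * ε + c₂ * h := by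
  -- Absolute values keep the constants nonnegative, as `L`, `B`, `T` are arbitrary reals.
  let D : ℝ := d * (1 + |L| * |T|)
  let a : ℝ := 2 * |L| * D + |L|
  let b : ℝ := 4 * |L| * |B| * D + 4 * |L| * |B|
  have hD : 0 ≤ D := by positivity
  have ha : 0 ≤ a := by positivity
  have hb : 0 ≤ b := by positivity
  -- The extra `2 * |B| + 1` in `c₂` leaves room for the drift `2 * |B| * h` within a step; the `+
  -- 1` makes the comparison with `ρ` strict.
  refine ⟨Real.exp (a * |T|), Real.exp (a * |T|) * (|T| * D),
    Real.exp (a * |T|) * (|T| * b) + (2 * |B| + 1), by positivity, by positivity, by positivity, ?_⟩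
  intro n r F A Y ε δ h ρ hA hL hB hε0 _ hε hY0 hδ hh hstep hρ
  have hδ0 : 0 ≤ δ := (norm_nonneg _).trans hδ
  have hβ : 0 ≤ D * ε + b * h := by positivity
  have hmono : ∀ t, 0 ≤ t → t ≤ T → Real.exp (a * t) * (δ + t * (D * ε + b * h)) ≤
      Real.exp (a * |T|) * δ + Real.exp (a * |T|) * (|T| * D) * ε +
        Real.exp (a * |T|) * (|T| * b) * h := by
    intro t ht0 htT
    have htT' : t ≤ |T| := htT.trans (le_abs_self T)
    calc Real.exp (a * t) * (δ + t * (D * ε + b * h))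
        ≤ Real.exp (a * |T|) * (δ + |T| * (D * ε + b * h)) := by gcongr
      _ = _ := by ring
  have key : ∀ k : ℕ, (k : ℝ) * h ≤ T →
      ‖Y k - A (k * h)‖ ≤ Real.exp (a * (k * h)) * (δ + k * h * (D * ε + b * h)) := by
    intro k
    induction k with
    | zero => intro _; simpa using hδ
    | succ k ih =>
      intro hk
      push_cast at hk ⊢
      have hk0 : 0 ≤ (k : ℝ) * h := by positivity
      have hkT : (k : ℝ) * h ≤ T := by linarith
      have hT0 : 0 ≤ T := hk0.trans hkT
      have hsub : Set.Icc ((k : ℝ) * h) ((k + 1) * h) ⊆ Set.Icc 0 T :=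
        Set.Icc_subset_Icc hk0 hk
      have hB0 : 0 ≤ B := (norm_nonneg _).trans (hB 0 ⟨le_rfl, hT0⟩ 0)
      obtain ⟨H, hH⟩ : ∃ H : TuckerIntegrator.Tensor r,
          ∀ j, (TuckerIntegrator.mat j H).rank = r j :=
        (hstep 0 (by push_cast; nlinarith)).exists_full_rank_core hY0
      have hdiff : ((k : ℝ) + 1) * h - k * h = h := by ring
      have ih' := ih hkT
      have hprop := (hstep k hk).error_propagation_le hH (L := |L|) (B := |B|) (T := |T|)
        (ε := ε) (ρ := ρ) (A := A) (by linarith)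
        (by rw [hdiff]; exact (by linarith : h ≤ T).trans (le_abs_self T)) (abs_nonneg L) hε0
        (fun t ht => (hA t (hsub ht)).mono hsub)
        (fun t ht X X' => (hL t (hsub ht) X X').trans
          (mul_le_mul_of_nonneg_right (le_abs_self L) (norm_nonneg _)))
        (fun t ht X => (hB t (hsub ht) X).trans (le_abs_self B))
        (fun t ht => hε t (hsub ht))
        (by rw [hdiff]; linarith [hmono _ hk0 hkT])
      rw [hdiff] at hprop
      have hg := TuckerIntegrator.gronwall_step_le ha hh.le hk0 hβ (norm_nonneg _) ih'
      have h1 : ((k : ℝ) + 1) * h = k * h + h := by ring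
      rw [h1] at hprop ⊢
      exact hprop.trans hg
  intro k hk
  have h1 : 0 ≤ (2 * |B| + 1) * h := by positivity
  have hk0 : 0 ≤ (k : ℝ) * h := by positivity
  linarith [key k hk, hmono _ hk0 hk]
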